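/- Let $n \ge 2$ and let $\alpha = (\alpha_1,\dots,\alpha_n) \in \mathbb{R}^n$ be a vector with all coordinates nonzero. Then for any real number $r$, the set $\{\nu \in [-1/2,1/2]^n : \alpha\cdot\nu = r\}$ has finite $(n-1)$-dimensional volume, and $$\operatorname{Vol}_{n-1}\bigl(\{\nu \in [-1/2,1/2]^n : \alpha\cdot\nu = r\}\bigr) = \frac{\|\alpha\|}{2^{n-1}\,(n-1)!\,\prod_{i=1}^n \alpha_i} \sum_{c \in \{-1,1\}^n} (-1)^{\#\{i \,:\, c_i = 1\}} \max\{2r - \alpha\cdot c,\, 0\}^{n-1},$$ where $\|\alpha\|$ is the Euclidean norm, $\cdot$ is the standard inner product, and $\operatorname{Vol}_{n-1}$ is $(n-1)$-dimensional volume (Hausdorff measure in $\mathbb{R}^n$, normalised to agree with Lebesgue measure on $(n-1)$-dimensional Euclidean space). -/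

import Mathlib

open scoped Nat

open MeasureTheory

/-! Since `α 0 ≠ 0`, the equation `α ⬝ ν = r` can be solved for `ν 0`. The section is then a
translated linear graph over the slab of the `(n-1)`-cube where the solved coordinate stays in
`[-1/2, 1/2]`, and the area factor is `‖α‖ / |α 0|` (`euclideanHausdorffMeasure_cube_hyperplane`).

The slab is a difference of two half-space sections, whose volumes are signed vertex sums
(`volume_real_cubeSection_Iic`). This goes by induction with Fubini: integrating over one more
coordinate raises the exponent by one, and the endpoints `±1/2` supply the two signs of the new
vertex coordinate. The same recursion, `signedVertexSum_succ`, finally merges the two slab terms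
into the sum over all `n` signs. -/

/-! ### Signed vertex sums: recursion and calculus -/

/-- The alternating sum of `k`-th powers of positive parts over the vertices of `[-1, 1]^m`. -/
noncomputable def signedVertexSum {m : ℕ} (k : ℕ) (a : Fin m → ℝ) (s : ℝ) : ℝ :=
  ∑ c ∈ Fintype.piFinset (fun _ : Fin m => ({-1, 1} : Finset ℝ)),
    (-1 : ℝ) ^ (Finset.univ.filter (fun i => c i = 1)).card *
      (max (s - ∑ i, a i * c i) 0) ^ k

theorem sum_piFinset_neg_one_one_succ {m : ℕ} (F : (Fin (m + 1) → ℝ) → ℝ) :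
    ∑ c ∈ Fintype.piFinset (fun _ : Fin (m + 1) => ({-1, 1} : Finset ℝ)), F c =
      ∑ c ∈ Fintype.piFinset (fun _ : Fin m => ({-1, 1} : Finset ℝ)), F (Fin.cons (-1) c) +
      ∑ c ∈ Fintype.piFinset (fun _ : Fin m => ({-1, 1} : Finset ℝ)), F (Fin.cons 1 c) := by
  have h := Finset.filter_piFinset_eq_map_consEquiv
    (fun _ : Fin (m + 1) => ({-1, 1} : Finset ℝ)) (fun _ => True)
  simp only [Finset.filter_true] at h
  rw [h, Finset.sum_map, Finset.sum_product, Finset.sum_pair (by norm_num)]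
  rfl

theorem signedVertexSum_succ {m : ℕ} (k : ℕ) (a : Fin (m + 1) → ℝ) (s : ℝ) :
    signedVertexSum k a s =
      signedVertexSum k (Fin.tail a) (s + a 0) - signedVertexSum k (Fin.tail a) (s - a 0) := by
  unfold signedVertexSum
  rw [sum_piFinset_neg_one_one_succ, sub_eq_add_neg, ← Finset.sum_neg_distrib]
  congr 1
  · refine Finset.sum_congr rfl fun c _ => ?_
    rw [Fin.card_filter_univ_succ, Fin.sum_univ_succ]
    simp only [Fin.cons_zero, Fin.cons_succ, Fin.tail]
    rw [if_neg (by norm_num)]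
    congr 3
    ring
  · refine Finset.sum_congr rfl fun c _ => ?_
    rw [Fin.card_filter_univ_succ, Fin.sum_univ_succ]
    simp only [Fin.cons_zero, Fin.cons_succ, Fin.tail]
    rw [if_pos trivial, pow_succ, mul_neg_one, neg_mul]
    congr 4
    ring

/-- Only the corner at `0` needs care: for `k ≠ 0` the derivative found on either side extends
continuously to it. -/
theorem hasDerivAt_max_zero_pow {k : ℕ} (hk : k ≠ 0) (x : ℝ) :
    HasDerivAt (fun y : ℝ => (max y 0) ^ (k + 1)) ((k + 1) * (max x 0) ^ k) x := by
  have hne : ∀ y : ℝ, y ≠ 0 →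
      HasDerivAt (fun y : ℝ => (max y 0) ^ (k + 1)) ((k + 1) * (max y 0) ^ k) y := by
    intro y hy
    rcases lt_or_gt_of_ne hy with h | h
    · rw [max_eq_right h.le, zero_pow hk, mul_zero]
      refine (hasDerivAt_const y (0 : ℝ)).congr_of_eventuallyEq ?_
      filter_upwards [gt_mem_nhds h] with z hz
      rw [max_eq_right hz.le, zero_pow k.succ_ne_zero]
    · rw [max_eq_left h.le]
      have := hasDerivAt_pow (k + 1) y
      simp only [Nat.cast_add, Nat.cast_one, Nat.add_sub_cancel] at this
      refine this.congr_of_eventuallyEq ?_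
      filter_upwards [lt_mem_nhds h] with z hz
      rw [max_eq_left hz.le]
  by_cases hx : x = 0
  · subst hx
    exact hasDerivAt_of_hasDerivAt_of_ne (g := fun y => (k + 1) * (max y 0) ^ k)
      (fun y hy => hne y hy) (by fun_prop) (by fun_prop)
  · exact hne x hx

theorem continuous_signedVertexSum {m : ℕ} (k : ℕ) (a : Fin m → ℝ) :
    Continuous (signedVertexSum k a) := by
  unfold signedVertexSum
  fun_prop

theorem hasDerivAt_signedVertexSum {m k : ℕ} (hk : k ≠ 0) (a : Fin m → ℝ) (s : ℝ) :
    HasDerivAt (signedVertexSum (k + 1) a) ((k + 1) * signedVertexSum k a s) s := by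
  unfold signedVertexSum
  rw [Finset.mul_sum]
  refine HasDerivAt.fun_sum fun c _ => ?_
  have h := ((hasDerivAt_max_zero_pow hk _).comp s
    ((hasDerivAt_id s).sub_const (∑ i, a i * c i))).const_mul
    ((-1 : ℝ) ^ (Finset.univ.filter (fun i => c i = 1)).card)
  refine h.congr_deriv ?_
  simp only [id]
  ring

theorem integral_signedVertexSum {m k : ℕ} (hk : k ≠ 0) (a : Fin m → ℝ) {b : ℝ} (hb : b ≠ 0)
    (s : ℝ) :
    ∫ t in (-1 / 2 : ℝ)..(1 / 2), signedVertexSum k a (2 * (s - b * t)) =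
      (signedVertexSum (k + 1) a (2 * s + b) - signedVertexSum (k + 1) a (2 * s - b)) /
        (2 * b * (k + 1)) := by
  have hk' : (k + 1 : ℝ) ≠ 0 := by positivity
  have h : ∀ t ∈ Set.uIcc (-1 / 2 : ℝ) (1 / 2), HasDerivAt
      (fun t => -(signedVertexSum (k + 1) a (2 * (s - b * t)) / (2 * b * (k + 1))))
      (signedVertexSum k a (2 * (s - b * t))) t := by
    intro t _
    have h1 : HasDerivAt (fun t => 2 * (s - b * t)) (2 * (-(b * 1))) t :=
      (((hasDerivAt_id t).const_mul b).const_sub s).const_mul 2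
    have h2 := (((hasDerivAt_signedVertexSum hk a (2 * (s - b * t))).comp t h1).div_const
      (2 * b * (k + 1))).neg
    refine h2.congr_deriv ?_
    field_simp
  rw [intervalIntegral.integral_eq_sub_of_hasDerivAt h
    (((continuous_signedVertexSum k a).comp (by fun_prop)).intervalIntegrable _ _)]
  rw [show 2 * (s - b * (1 / 2)) = 2 * s - b by ring,
    show 2 * (s - b * (-1 / 2)) = 2 * s + b by ring]
  ring

/-! ### Volumes of half-space and slab sections -/

/-- The points of the cube `[-1/2, 1/2]^m` at which `x ↦ a ⬝ x` takes a value in `I`. -/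
def cubeSection {m : ℕ} (a : Fin m → ℝ) (I : Set ℝ) : Set (Fin m → ℝ) :=
  {x | (∀ i, x i ∈ Set.Icc (-1 / 2 : ℝ) (1 / 2)) ∧ ∑ i, a i * x i ∈ I}

theorem measurableSet_cubeSection {m : ℕ} (a : Fin m → ℝ) {I : Set ℝ} (hI : MeasurableSet I) :
    MeasurableSet (cubeSection a I) := by
  unfold cubeSection
  refine MeasurableSet.inter (s₁ := {x : Fin m → ℝ | ∀ i, x i ∈ Set.Icc (-1 / 2 : ℝ) (1 / 2)}) ?_ ?_
  · rw [Set.ofPred_forall]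
    exact MeasurableSet.iInter fun i => measurableSet_Icc.preimage (measurable_pi_apply i)
  · exact hI.preimage (by fun_prop)

theorem volume_cubeSection_ne_top {m : ℕ} (a : Fin m → ℝ) (I : Set ℝ) :
    volume (cubeSection a I) ≠ ⊤ := by
  refine ne_top_of_le_ne_top ?_ (measure_mono (t := Set.pi Set.univ
    fun _ : Fin m => Set.Icc (-1 / 2 : ℝ) (1 / 2)) fun x hx i _ => hx.1 i)
  exact (isCompact_univ_pi fun _ => isCompact_Icc).measure_ne_top

theorem volume_real_cubeSection_succ {m : ℕ} (a : Fin (m + 1) → ℝ) (s : ℝ) :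
    volume.real (cubeSection a (Set.Iic s)) =
      ∫ t in (-1 / 2 : ℝ)..(1 / 2),
        volume.real (cubeSection (Fin.tail a) (Set.Iic (s - a 0 * t))) := by
  have hmp := (volume_preserving_piFinSuccAbove (fun _ : Fin (m + 1) => ℝ) 0).symm
  have hms := measurableSet_cubeSection a (measurableSet_Iic (a := s))
  have hsec : ∀ t : ℝ, volume (Prod.mk t ⁻¹'
      ((MeasurableEquiv.piFinSuccAbove (fun _ : Fin (m + 1) => ℝ) 0).symm ⁻¹'
        cubeSection a (Set.Iic s))) =
      (Set.Icc (-1 / 2 : ℝ) (1 / 2)).indicator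
        (fun t => volume (cubeSection (Fin.tail a) (Set.Iic (s - a 0 * t)))) t := by
    intro t
    by_cases ht : t ∈ Set.Icc (-1 / 2 : ℝ) (1 / 2)
    · rw [Set.indicator_of_mem ht]
      congr 1
      ext x
      simp only [cubeSection, Set.mem_preimage, Set.mem_ofPred_eq, Set.mem_Iic,
        MeasurableEquiv.piFinSuccAbove_symm_apply, Fin.insertNthEquiv_apply, Fin.insertNth_zero',
        Fin.forall_fin_succ, Fin.sum_univ_succ, Fin.cons_zero, Fin.cons_succ, Fin.tail, ht,
        true_and, le_sub_iff_add_le']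
    · rw [Set.indicator_of_notMem ht]
      convert measure_empty (μ := volume)
      ext x
      simp only [cubeSection, Set.mem_preimage, Set.mem_ofPred_eq,
        MeasurableEquiv.piFinSuccAbove_symm_apply, Fin.insertNthEquiv_apply, Fin.insertNth_zero',
        Fin.forall_fin_succ, Fin.cons_zero, ht, false_and, Set.mem_empty_iff_false]
  rw [measureReal_def, ← hmp.measure_preimage hms.nullMeasurableSet, Measure.volume_eq_prod,
    Measure.prod_apply (hmp.measurable hms), ← integral_toReal
      (measurable_measure_prodMk_left (hmp.measurable hms)).aemeasurable]
  · rw [intervalIntegral.integral_of_le (by norm_num), ← integral_Icc_eq_integral_Ioc,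
      ← integral_indicator measurableSet_Icc]
    refine integral_congr_ae (.of_forall fun t => ?_)
    simp only [hsec]
    by_cases ht : t ∈ Set.Icc (-1 / 2 : ℝ) (1 / 2)
    · simp only [Set.indicator_of_mem ht, measureReal_def]
    · simp only [Set.indicator_of_notMem ht, ENNReal.toReal_zero]
  · refine .of_forall fun t => ?_
    rw [hsec]
    by_cases ht : t ∈ Set.Icc (-1 / 2 : ℝ) (1 / 2)
    · rw [Set.indicator_of_mem ht]
      exact (volume_cubeSection_ne_top _ _).lt_top
    · rw [Set.indicator_of_notMem ht]
      exact ENNReal.zero_lt_top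

theorem signedVertexSum_fin_zero (k : ℕ) (a : Fin 0 → ℝ) (s : ℝ) :
    signedVertexSum k a s = (max s 0) ^ k := by
  simp [signedVertexSum]

/-- The induction starts here because dimension `0` fails: with `x ^ 0 = 1` the formula would give
`1` even for `s < 0`. -/
theorem volume_real_cubeSection_fin_one (a : Fin 1 → ℝ) (ha : a 0 ≠ 0) (s : ℝ) :
    volume.real (cubeSection a (Set.Iic s)) =
      (max (2 * s + a 0) 0 - max (2 * s - a 0) 0) / (2 * a 0) := by
  have hmp : MeasurePreserving (MeasurableEquiv.funUnique (Fin 1) ℝ).symm volume volume := by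
    convert! (volume_preserving_funUnique (Fin 1) ℝ).symm
  have hset : (MeasurableEquiv.funUnique (Fin 1) ℝ).symm ⁻¹' cubeSection a (Set.Iic s) =
      {t | t ∈ Set.Icc (-1 / 2 : ℝ) (1 / 2) ∧ a 0 * t ≤ s} := by
    ext t
    simp [cubeSection]
  rw [measureReal_def, ← hmp.measure_preimage
    (measurableSet_cubeSection a measurableSet_Iic).nullMeasurableSet, hset, ← measureReal_def]
  rcases lt_or_gt_of_ne ha with h | h
  · have : {t | t ∈ Set.Icc (-1 / 2 : ℝ) (1 / 2) ∧ a 0 * t ≤ s} =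
        Set.Icc (max (-1 / 2) (s / a 0)) (1 / 2) := by
      ext t
      simp only [Set.mem_ofPred_eq, Set.mem_Icc, max_le_iff, div_le_iff_of_neg h, mul_comm (a 0)]
      tauto
    rw [this, Real.volume_real_Icc, eq_div_iff (by simpa using ha)]
    -- Writing `s = u * b` removes the division, so each case is polynomial arithmetic in `u` and
    -- `b`.
    have hs : s / a 0 * a 0 = s := div_mul_cancel₀ _ ha
    generalize s / a 0 = u at *
    generalize a 0 = b at *
    subst hs
    rcases max_cases (-1 / 2) u with h1 | h1 <;>
    rcases max_cases (1 / 2 - max (-1 / 2) u) 0 with h2 | h2 <;>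
    rcases max_cases (2 * (u * b) + b) 0 with h3 | h3 <;>
    rcases max_cases (2 * (u * b) - b) 0 with h4 | h4 <;>
    rw [h2.1, h3.1, h4.1] <;> rw [h1.1] at * <;> nlinarith
  · have : {t | t ∈ Set.Icc (-1 / 2 : ℝ) (1 / 2) ∧ a 0 * t ≤ s} =
        Set.Icc (-1 / 2) (min (1 / 2) (s / a 0)) := by
      ext t
      simp only [Set.mem_ofPred_eq, Set.mem_Icc, le_min_iff, le_div_iff₀ h, mul_comm (a 0)]
      tauto
    rw [this, Real.volume_real_Icc, eq_div_iff (by simpa using ha)]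
    have hs : s / a 0 * a 0 = s := div_mul_cancel₀ _ ha
    generalize s / a 0 = u at *
    generalize a 0 = b at *
    subst hs
    rcases min_cases (1 / 2) u with h1 | h1 <;>
    rcases max_cases (min (1 / 2) u - (-1 / 2)) 0 with h2 | h2 <;>
    rcases max_cases (2 * (u * b) + b) 0 with h3 | h3 <;>
    rcases max_cases (2 * (u * b) - b) 0 with h4 | h4 <;>
    rw [h2.1, h3.1, h4.1] <;> rw [h1.1] at * <;> nlinarith

theorem volume_real_cubeSection_Iic {m : ℕ} (hm : m ≠ 0) (a : Fin m → ℝ) (ha : ∀ i, a i ≠ 0)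
    (s : ℝ) :
    volume.real (cubeSection a (Set.Iic s)) =
      signedVertexSum m a (2 * s) / (2 ^ m * (m ! : ℝ) * ∏ i, a i) := by
  obtain ⟨m, rfl⟩ := Nat.exists_eq_succ_of_ne_zero hm
  clear hm
  revert s
  revert a
  induction m with
  | zero =>
    intro a ha s
    rw [volume_real_cubeSection_fin_one a (ha 0), signedVertexSum_succ, signedVertexSum_fin_zero,
      signedVertexSum_fin_zero]
    simp
  | succ m ih =>
    intro a ha s
    have ha' : ∀ i, Fin.tail a i ≠ 0 := fun i => ha i.succ
    rw [volume_real_cubeSection_succ]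
    simp only [ih (Fin.tail a) ha']
    rw [intervalIntegral.integral_div, integral_signedVertexSum (Nat.succ_ne_zero m) _ (ha 0),
      signedVertexSum_succ _ a, Fin.prod_univ_succ a, Nat.factorial_succ (m + 1), div_div]
    congr 1
    simp only [Fin.tail, Nat.succ_eq_add_one]
    push_cast
    ring

theorem volume_hyperplane {m : ℕ} (a : Fin m → ℝ) {i : Fin m} (hi : a i ≠ 0) (s : ℝ) :
    volume {x : Fin m → ℝ | ∑ i, a i * x i = s} = 0 := by
  let f : (Fin m → ℝ) →ₗ[ℝ] ℝ := ∑ i, a i • LinearMap.proj i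
  have hf : ∀ x, f x = ∑ i, a i * x i := fun x => by simp [f]
  let S : AffineSubspace ℝ (Fin m → ℝ) :=
    (AffineSubspace.mk' s ⊥).comap f.toAffineMap
  have hS : {x : Fin m → ℝ | ∑ i, a i * x i = s} = S := by
    ext x
    simp [S, hf, sub_eq_zero]
  rw [hS]
  refine Measure.addHaar_affineSubspace _ _ fun htop => ?_
  have hmem : ∀ x : Fin m → ℝ, ∑ i, a i * x i = s := fun x => by
    have : x ∈ (S : Set (Fin m → ℝ)) := by rw [htop]; trivial
    rwa [← hS] at this
  have h0 := hmem 0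
  have h1 := hmem (Pi.single i 1)
  simp [Pi.single_apply] at h0 h1
  exact hi (h1.trans h0.symm)

theorem volume_real_cubeSection_Icc {m : ℕ} (hm : m ≠ 0) (a : Fin m → ℝ) (ha : ∀ i, a i ≠ 0)
    {s t : ℝ} (hst : s ≤ t) :
    volume.real (cubeSection a (Set.Icc s t)) =
      (signedVertexSum m a (2 * t) - signedVertexSum m a (2 * s)) /
        (2 ^ m * (m ! : ℝ) * ∏ i, a i) := by
  have hsub : cubeSection a (Set.Iic s) ⊆ cubeSection a (Set.Iic t) :=
    fun x hx => ⟨hx.1, le_trans hx.2 hst⟩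
  have hdiff : cubeSection a (Set.Iic t) \ cubeSection a (Set.Iic s) =
      cubeSection a (Set.Ioc s t) := by
    ext x
    simp only [cubeSection, Set.mem_sdiff, Set.mem_ofPred_eq, Set.mem_Iic, Set.mem_Ioc, not_and,
      not_le]
    tauto
  have hae : volume (cubeSection a (Set.Icc s t)) = volume (cubeSection a (Set.Ioc s t)) := by
    refine le_antisymm ?_ (measure_mono fun x hx => ⟨hx.1, Set.Ioc_subset_Icc_self hx.2⟩)
    refine (measure_mono (t := cubeSection a (Set.Ioc s t) ∪ {x | ∑ i, a i * x i = s}) ?_).trans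
      ((measure_union_le _ _).trans_eq ?_)
    · intro x hx
      rcases hx.2.1.eq_or_lt with h | h
      · exact Or.inr h.symm
      · exact Or.inl ⟨hx.1, h, hx.2.2⟩
    · rw [volume_hyperplane a (ha ⟨0, Nat.pos_of_ne_zero hm⟩), add_zero]
  rw [measureReal_def, hae, ← measureReal_def, ← hdiff,
    measureReal_sdiff hsub (measurableSet_cubeSection a measurableSet_Iic)
      (volume_cubeSection_ne_top _ _), volume_real_cubeSection_Iic hm a ha,
    volume_real_cubeSection_Iic hm a ha, sub_div]

/-! ### Hyperplane sections as graphs -/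

/-- The linear map `x ↦ (-u ⬝ x, x)`, whose range is a hyperplane graph over the last
coordinates. -/
noncomputable def graphMap {m : ℕ} (u : Fin m → ℝ) :
    EuclideanSpace ℝ (Fin m) →ₗ[ℝ] EuclideanSpace ℝ (Fin (m + 1)) where
  toFun x := WithLp.toLp 2 (Fin.cons (-∑ i, u i * x i) x.ofLp)
  map_add' x y := by
    ext i
    refine Fin.cases ?_ (fun i => ?_) i
    · simp [mul_add, Finset.sum_add_distrib, add_comm]
    · simp
  map_smul' c x := by
    ext i
    refine Fin.cases ?_ (fun i => ?_) i
    · simp [Finset.mul_sum, mul_left_comm]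
    · simp

theorem graphMap_zero {m : ℕ} (u : Fin m → ℝ) (x : EuclideanSpace ℝ (Fin m)) :
    graphMap u x 0 = -∑ i, u i * x i := rfl

theorem graphMap_succ {m : ℕ} (u : Fin m → ℝ) (x : EuclideanSpace ℝ (Fin m)) (i : Fin m) :
    graphMap u x i.succ = x i := rfl

/-- The Gram matrix of the images of the basis vectors is `1 + u uᵀ`, a rank-one update of the
identity. -/
theorem normDet_graphMap_sq {m : ℕ} (u : Fin m → ℝ) :
    (graphMap u).normDet ^ 2 = 1 + ∑ i, u i ^ 2 := by
  have h := (graphMap u).normDet_sq_eq_det_gram (EuclideanSpace.basisFun (Fin m) ℝ)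
  have hgram : Matrix.gram ℝ (fun i => graphMap u (EuclideanSpace.basisFun (Fin m) ℝ i)) =
      1 + Matrix.replicateCol Unit u * Matrix.replicateRow Unit u := by
    ext i j
    rw [Matrix.gram_apply, PiLp.inner_apply, Fin.sum_univ_succ]
    simp only [graphMap_zero, graphMap_succ]
    simp [Matrix.mul_apply, Matrix.one_apply, mul_comm, add_comm, eq_comm]
  rw [hgram, Matrix.det_one_add_replicateCol_mul_replicateRow] at h
  simpa [dotProduct, sq] using h

theorem normDet_graphMap_tail_div {m : ℕ} (α : EuclideanSpace ℝ (Fin (m + 1))) (h0 : α 0 ≠ 0) :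
    (graphMap fun i => α i.succ / α 0).normDet = ‖α‖ / |α 0| := by
  rw [← sq_eq_sq₀ (LinearMap.normDet_nonneg _) (by positivity), normDet_graphMap_sq, div_pow,
    EuclideanSpace.norm_sq_eq, Fin.sum_univ_succ, sq_abs]
  simp only [Real.norm_eq_abs, sq_abs, div_pow]
  rw [add_div, Finset.sum_div, div_self (pow_ne_zero 2 h0)]

/-- A hyperplane section of the cube is an affine image of a slab of the cube of one dimension
less. -/
theorem cubeSection_singleton_eq_image {m : ℕ} (α : EuclideanSpace ℝ (Fin (m + 1)))
    (h0 : α 0 ≠ 0) (r : ℝ) :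
    {ν : EuclideanSpace ℝ (Fin (m + 1)) |
      (∀ i, ν i ∈ Set.Icc (-1 / 2 : ℝ) (1 / 2)) ∧ ∑ i, α i * ν i = r} =
    (fun y => EuclideanSpace.single 0 (r / α 0) + y) ''
      (graphMap (fun i => α i.succ / α 0) '' (WithLp.ofLp ⁻¹'
        cubeSection (fun i => α i.succ) (Set.Icc (r - |α 0| / 2) (r + |α 0| / 2)))) := by
  have hsum : ∀ x : Fin m → ℝ, ∑ i, α i.succ / α 0 * x i = (∑ i, α i.succ * x i) / α 0 := by
    intro x
    rw [Finset.sum_div]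
    exact Finset.sum_congr rfl fun i _ => by ring
  -- The solved coordinate is `(r - σ) / α 0`; bounding it by `1/2` in absolute value gives the slab
  -- of half-width `|α 0| / 2`.
  have hiff : ∀ σ : ℝ, σ ∈ Set.Icc (r - |α 0| / 2) (r + |α 0| / 2) ↔
      r / α 0 + -(σ / α 0) ∈ Set.Icc (-1 / 2 : ℝ) (1 / 2) := by
    intro σ
    rw [show r / α 0 + -(σ / α 0) = (r - σ) / α 0 by ring,
      show (-1 / 2 : ℝ) = -(1 / 2) by norm_num, Set.mem_Icc, Set.mem_Icc, ← abs_le (a := (r - σ) / α 0), abs_div,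
      div_le_iff₀ (abs_pos.mpr h0), abs_le]
    constructor <;> rintro ⟨h1, h2⟩ <;> constructor <;> linarith
  rw [Set.image_image]
  ext ν
  simp only [Set.mem_image, Set.mem_preimage, Set.mem_ofPred_eq, cubeSection]
  constructor
  · rintro ⟨hν, hr⟩
    rw [Fin.sum_univ_succ] at hr
    have hν0 : r / α 0 + -((∑ i : Fin m, α i.succ * ν i.succ) / α 0) = ν 0 := by
      rw [← hr]
      field_simp
      ring
    refine ⟨WithLp.toLp 2 fun i => ν i.succ, ⟨fun i => hν i.succ, ?_⟩, ?_⟩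
    · rw [hiff, hν0]
      exact hν 0
    · ext i
      refine Fin.cases ?_ (fun i => ?_) i
      · rw [PiLp.add_apply, graphMap_zero, hsum]
        simpa using hν0
      · rw [PiLp.add_apply, graphMap_succ]
        simp
  · rintro ⟨x, ⟨hx, hs⟩, rfl⟩
    rw [hiff, ← hsum] at hs
    constructor
    · intro i
      refine Fin.cases ?_ (fun i => ?_) i
      · rw [PiLp.add_apply, graphMap_zero]
        simpa using hs
      · rw [PiLp.add_apply, graphMap_succ]
        simpa using hx i
    · rw [Fin.sum_univ_succ]
      simp only [PiLp.add_apply, graphMap_zero, graphMap_succ, hsum]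
      simp
      field_simp
      ring

theorem euclideanHausdorffMeasure_cube_hyperplane {m : ℕ} (α : EuclideanSpace ℝ (Fin (m + 1)))
    (h0 : α 0 ≠ 0) (r : ℝ) :
    Measure.euclideanHausdorffMeasure m
      {ν : EuclideanSpace ℝ (Fin (m + 1)) |
        (∀ i, ν i ∈ Set.Icc (-1 / 2 : ℝ) (1 / 2)) ∧ ∑ i, α i * ν i = r} =
    ENNReal.ofReal (‖α‖ / |α 0|) *
      volume (cubeSection (fun i => α i.succ) (Set.Icc (r - |α 0| / 2) (r + |α 0| / 2))) := by
  have h := (graphMap fun i => α i.succ / α 0).euclideanHausdorffMeasure_image_eq_normDet_mul_volume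
    (WithLp.ofLp ⁻¹'
        cubeSection (fun i => α i.succ) (Set.Icc (r - |α 0| / 2) (r + |α 0| / 2)))
  rw [finrank_euclideanSpace_fin, normDet_graphMap_tail_div α h0,
    (PiLp.volume_preserving_ofLp (Fin m)).measure_preimage
      (measurableSet_cubeSection _ measurableSet_Icc).nullMeasurableSet] at h
  rw [cubeSection_singleton_eq_image α h0, (isometry_add_left _).euclideanHausdorffMeasure_image, h]

theorem theorem3p4 (n : ℕ) (hn : 2 ≤ n) (α : EuclideanSpace ℝ (Fin n)) (hα : ∀ i, α i ≠ 0)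
    (r : ℝ) :
    MeasureTheory.Measure.euclideanHausdorffMeasure (n - 1)
        {ν : EuclideanSpace ℝ (Fin n) |
          (∀ i, ν i ∈ Set.Icc (-1 / 2 : ℝ) (1 / 2)) ∧ ∑ i, α i * ν i = r} ≠ ⊤ ∧
    (MeasureTheory.Measure.euclideanHausdorffMeasure (n - 1)
        {ν : EuclideanSpace ℝ (Fin n) |
          (∀ i, ν i ∈ Set.Icc (-1 / 2 : ℝ) (1 / 2)) ∧ ∑ i, α i * ν i = r}).toReal =
      ‖α‖ / (2 ^ (n - 1) * ((n - 1)! : ℝ) * ∏ i, α i) *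
        ∑ c ∈ Fintype.piFinset (fun _ : Fin n => ({-1, 1} : Finset ℝ)),
          (-1 : ℝ) ^ (Finset.univ.filter (fun i => c i = 1)).card *
            (max (2 * r - ∑ i, α i * c i) 0) ^ (n - 1) := by
  obtain ⟨m, rfl⟩ : ∃ m, n = m + 1 := ⟨n - 1, by omega⟩
  have hm : m ≠ 0 := by omega
  have h0 := hα 0
  rw [Nat.add_sub_cancel, euclideanHausdorffMeasure_cube_hyperplane α h0]
  refine ⟨ENNReal.mul_ne_top ENNReal.ofReal_ne_top (volume_cubeSection_ne_top _ _), ?_⟩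
  rw [ENNReal.toReal_mul, ENNReal.toReal_ofReal (by positivity), ← measureReal_def,
    volume_real_cubeSection_Icc hm _ (fun i => hα i.succ) (by linarith [abs_nonneg (α 0)]),
    show 2 * (r + |α 0| / 2) = 2 * r + |α 0| by ring,
    show 2 * (r - |α 0| / 2) = 2 * r - |α 0| by ring]
  change _ = _ * signedVertexSum m α.ofLp (2 * r)
  rw [signedVertexSum_succ, Fin.prod_univ_succ]
  have hP : ∏ i : Fin m, α i.succ ≠ 0 := Finset.prod_ne_zero_iff.mpr fun i _ => hα i.succ
  have hf : (m ! : ℝ) ≠ 0 := by positivity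
  -- For `α 0 < 0` the two endpoints swap, and the resulting sign cancels that of `|α 0| = -α 0` in
  -- the denominator.
  rcases abs_cases (α 0) with ⟨h, _⟩ | ⟨h, _⟩
  · rw [h]
    simp only [Fin.tail_def]
    field_simp
  · rw [h, ← sub_eq_add_neg, sub_neg_eq_add]
    simp only [Fin.tail_def]
    field_simp
    ring
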